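/- **Setting.** Each link $I_k$ ($k=1,2,3$) of a junction $J$ carries a continuous fundamental diagram $f_k:[0,\rho_k^{jam}]\to[0,C_k]$ with $f_k(0)=f_k(\rho^{jam}_k)=0$, strictly increasing on $[0,\rho_k^*]$ (free flow) and strictly decreasing on $[\rho_k^*,\rho_k^{jam}]$ (congestion), where $0<\rho_k^*<\rho_k^{jam}$ and $C_k=f_k(\rho_k^*)$. At density $\rho$ the demand of an incoming link is $D_k=f_k(\rho)$ if $\rho\le\rho_k^*$ and $C_k$ otherwise; the supply of an outgoing link is $S_k=C_k$ if $\rho\le\rho_k^*$ and $f_k(\rho)$ otherwise. *Diverge* (incoming link 1, outgoing links 2, 3; constant turning rates $\alpha_{1,2},\alpha_{1,3}>0$, $\alpha_{1,2}+\alpha_{1,3}=1$): the flows through $J$ are $q_1=\min\{D_1,S_2/\alpha_{1,2},S_3/\alpha_{1,3}\}$, $q_2=\alpha_{1,2}q_1$, $q_3=\alpha_{1,3}q_1$. *Merge* (incoming links 1, 2, outgoing link 3; right-of-way parameter $p\in(0,1)$): $(q_1,q_2)$ maximizes $q_1+q_2$ subject to $0\le q_1\le D_1$, $0\le q_2\le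 D_2$, $q_1+q_2\le S_3$, and among all maximizers it is the one closest to the line $q_2=p\,q_1$; $q_3=q_1+q_2$. The Riemann solver assigns to the densities $(\rho_k)$ at $J$ new densities $(\hat\rho_k)$ with $f_k(\hat\rho_k)=q_k$: $\hat\rho_k=\rho_k$ if $f_k(\rho_k)=q_k$, and otherwise $\hat\rho_k$ is congested (or critical) on an incoming link and free (or critical) on an outgoing link. *Interaction.* The junction is at rest in a state fixed by the Riemann solver; a front on a link $I_i$, between the density $\rho_i^-$ at $J$ and a density $\rho_i^+$ behind it, moving towards $J$ with its Rankine–Hugoniot speed, hits $J$ (fronts are shocks, or rarefaction fronts whose two states lie in the same phase). The Riemann problem with $\rho_i^-$ replaced by $\rho_i^+$ is solved, and on each link $I_j$ a wave (possibly trivial) is produced, from the density on $I_j$ in these Riemann data to the new density. Let $\Delta\rho_i,\Delta q_i$ be the jumps of density and flux across the arriving front and $\Delta\rho_j,\Delta q_j$ those across the wave produced on $I_j$ (for $j=i$: across the wave reflected into $I_i$). If the arriving front is shifted in space by $\xi_i$, the interaction time changes by $-\xi_i/s_i$, with $s_i=\Delta q_i/\Delta\rho_i$, and so the front produced on $I_j$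 is shifted by $\xi_j=s_j\xi_i/s_i$, with $s_j=\Delta q_j/\Delta\rho_j$. The corresponding tangent-vector norms are $|\xi_i\Delta\rho_i|$ and $|\xi_j\Delta\rho_j|$. **Proposition.** (a) For merge and diverge junctions, in every interaction $$\xi_j\Delta\rho_j=\frac{\Delta q_j}{\Delta q_i}\,\xi_i\Delta\rho_i,\qquad |\xi_j\Delta\rho_j|=\frac{|\Delta q_j|}{|\Delta q_i|}\,|\xi_i\Delta\rho_i| .$$ (b) For a diverge junction put $$(\gamma_{ij})=\begin{pmatrix}1&\alpha_{1,2}&\alpha_{1,3}\\ 1/\alpha_{1,2}&1&\alpha_{1,3}/\alpha_{1,2}\\ 1/\alpha_{1,3}&\alpha_{1,2}/\alpha_{1,3}&1\end{pmatrix}.$$ Then $\gamma_{ij}\gamma_{jk}=\gamma_{ik}$ for all $i,j,k$, and for $j\neq i$ one has $|\Delta q_j|/|\Delta q_i|\le\gamma_{ij}$, with equality if the interaction produces no wave on $I_i$. (c) For merge and diverge junctions the multiplication factors are uniformly bounded, regardless of the number of interactions: there is a constant $C$, depending only on $(\alpha_{1,2},\alpha_{1,3})$, respectively on $p$, such that for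 all fundamental diagrams, every $N\ge1$ and every chain of $N$ interactions with $J$ in which the wave produced on link $I_{i_k}$ by the $k$-th interaction returns to $J$ on that link as the arriving wave of the $(k+1)$-st (the states of $J$ and the strengths of the waves being otherwise arbitrary), $$\prod_{k=1}^{N}\frac{|\Delta q_{i_k}^{(k)}|}{|\Delta q_{i_{k-1}}^{(k)}|}\le C,$$ where in the $k$-th interaction the wave arrives on $I_{i_{k-1}}$ and the wave followed is the one produced on $I_{i_k}$. Consequently, if the norm of the tangent vector carried by the wave does not increase on the links between two interactions with $J$, then after the $N$ interactions it is at most $C$ times its value before the first one. -/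

import Mathlib

noncomputable section

namespace TrafficJunction

/-- A fundamental diagram: the flow `f` as a function of the density in `[0, ρjam]`, strictly
increasing in the free flow phase `[0, ρcrit]` and strictly decreasing in the congested phase
`[ρcrit, ρjam]`, so that each flow below capacity is attained by exactly one density of each phase.
The triangular fundamental diagram is of this kind. -/
structure FundamentalDiagram where
  f : ℝ → ℝ
  ρcrit : ℝ
  ρjam : ℝ
  crit_pos : 0 < ρcrit
  crit_lt_jam : ρcrit < ρjam
  f_zero : f 0 = 0
  f_jam : f ρjam = 0
  continuousOn_f : ContinuousOn f (Set.Icc 0 ρjam)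
  strictMonoOn_f : StrictMonoOn f (Set.Icc 0 ρcrit)
  strictAntiOn_f : StrictAntiOn f (Set.Icc ρcrit ρjam)

namespace FundamentalDiagram

variable (F : FundamentalDiagram)

/-- The flow capacity `C`. -/
def capacity : ℝ := F.f F.ρcrit

/-- The regime is `r = 1` (congested) for `ρ > ρcrit` and `r = 0` (free flow) otherwise. -/
def Congested (ρ : ℝ) : Prop := F.ρcrit < ρ

open Classical in
/-- The demand of an incoming link whose density at the junction is `ρ`. -/
def demand (ρ : ℝ) : ℝ := if F.Congested ρ then F.capacity else F.f ρ

open Classical in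
/-- The supply of an outgoing link whose density at the junction is `ρ`. -/
def supply (ρ : ℝ) : ℝ := if F.Congested ρ then F.f ρ else F.capacity

/-- Rankine-Hugoniot speed of a front between the densities `ρ` and `ρ'`
(symmetric in its two arguments). -/
def speed (ρ ρ' : ℝ) : ℝ := (F.f ρ' - F.f ρ) / (ρ' - ρ)

/-- The fronts of a wave-front tracking approximation, with left state `l` and right state `r`:
shocks (`l < r`), and rarefaction fronts (`r < l`). A rarefaction fan through the critical density
is always split at the critical density, so the two states of a rarefaction front belong to the
same phase. -/
def IsFront (l r : ℝ) : Prop :=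
  l ∈ Set.Icc 0 F.ρjam ∧ r ∈ Set.Icc 0 F.ρjam ∧
    (l < r ∨ (r < l ∧ (l ≤ F.ρcrit ∨ F.ρcrit ≤ r)))

end FundamentalDiagram

/-- A link at a junction is incoming (the junction is its exit `b`) or outgoing (the junction is
its entrance `a`). -/
inductive Side
  | incoming
  | outgoing

/-- A junction of three links: `rule m q` says that `q` are the flows through the junction
(out of the incoming links, into the outgoing ones), given the demands `m k` of the incoming links
`k` and the supplies `m k` of the outgoing links `k`. Only the two junctions `diverge` and `merge`
below are considered. -/
structure Junction where
  link : Fin 3 → FundamentalDiagram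
  side : Fin 3 → Side
  rule : (Fin 3 → ℝ) → (Fin 3 → ℝ) → Prop

/-- The first-in-first-out diverge rule with incoming link `0`, outgoing links `1` and `2` and
turning rates `α₁`, `α₂` towards them. -/
def IsDivergeFlux (α₁ α₂ : ℝ) (m q : Fin 3 → ℝ) : Prop :=
  q 0 = min (m 0) (min (m 1 / α₁) (m 2 / α₂)) ∧ q 1 = α₁ * q 0 ∧ q 2 = α₂ * q 0

/-- The pairs of flows out of the incoming links `0` and `1` of a merge that respect the demands
`m 0`, `m 1` and the supply `m 2` of the outgoing link. -/
def MergeFeasible (m : Fin 3 → ℝ) (x y : ℝ) : Prop :=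
  0 ≤ x ∧ x ≤ m 0 ∧ 0 ≤ y ∧ y ≤ m 1 ∧ x + y ≤ m 2

/-- The merge rule with right-of-way parameter `p`, incoming links `0`, `1`, outgoing link `2`:
the flow through the junction is maximal, and among the points of maximal flow the chosen one is
closest to the line `p x = y` (the distance of `(x, y)` from it is `|p x - y| / √(1 + p²)`). -/
def IsMergeFlux (p : ℝ) (m q : Fin 3 → ℝ) : Prop :=
  MergeFeasible m (q 0) (q 1) ∧ q 2 = q 0 + q 1 ∧
    (∀ x y, MergeFeasible m x y → x + y ≤ q 0 + q 1) ∧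
    (∀ x y, MergeFeasible m x y → x + y = q 0 + q 1 → |p * q 0 - q 1| ≤ |p * x - y|)

/-- The diverge junction. -/
def diverge (α₁ α₂ : ℝ) (link : Fin 3 → FundamentalDiagram) : Junction where
  link := link
  side := ![Side.incoming, Side.outgoing, Side.outgoing]
  rule := IsDivergeFlux α₁ α₂

/-- The merge junction. -/
def merge (p : ℝ) (link : Fin 3 → FundamentalDiagram) : Junction where
  link := link
  side := ![Side.incoming, Side.incoming, Side.outgoing]
  rule := IsMergeFlux p

namespace Junction

variable (J : Junction)

/-- The demand (incoming link) or supply (outgoing link) of link `k` in the state `ρ`. -/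
def bound (ρ : Fin 3 → ℝ) (k : Fin 3) : ℝ :=
  match J.side k with
  | Side.incoming => (J.link k).demand (ρ k)
  | Side.outgoing => (J.link k).supply (ρ k)

/-- The densities on link `k` that can be created at the junction: in the congested phase on an
incoming link, in the free flow phase on an outgoing link (the critical density counts as both). -/
def Reachable (k : Fin 3) (σ : ℝ) : Prop :=
  match J.side k with
  | Side.incoming => (J.link k).ρcrit ≤ σ
  | Side.outgoing => σ ≤ (J.link k).ρcrit

/-- `σ` are the densities at the junction that the Riemann solver assigns to the Riemann data `ρ`:
their flows obey the junction rule for the demands and supplies of `ρ`; where the flow of `ρ k` is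
already the right one nothing changes, and elsewhere the new density is such that the
wave between `ρ k` and `σ k` leaves the junction. -/
def IsRiemannSolution (ρ σ : Fin 3 → ℝ) : Prop :=
  (∀ k, ρ k ∈ Set.Icc 0 (J.link k).ρjam) ∧ (∀ k, σ k ∈ Set.Icc 0 (J.link k).ρjam) ∧
    J.rule (J.bound ρ) (fun k => (J.link k).f (σ k)) ∧
    ∀ k, σ k = ρ k ∨ ((J.link k).f (σ k) ≠ (J.link k).f (ρ k) ∧ J.Reachable k (σ k))

/-- A front on link `i` that has the density `ρ` on the side of the junction and `ρ'` on the side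
away from it, and that moves towards the junction. -/
def Approaching (i : Fin 3) (ρ ρ' : ℝ) : Prop :=
  match J.side i with
  | Side.incoming => (J.link i).IsFront ρ' ρ ∧ 0 < (J.link i).speed ρ ρ'
  | Side.outgoing => (J.link i).IsFront ρ ρ' ∧ (J.link i).speed ρ ρ' < 0

/-- An interaction of a wave with the junction: the junction is at rest in the state `before` (the
solution of its own Riemann problem), then a front on the link `road` with density `arriving`
behind it hits the junction, and the new Riemann problem is solved by the state `after`. -/
structure Interaction where
  before : Fin 3 → ℝ
  road : Fin 3
  arriving : ℝ
  after : Fin 3 → ℝ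
  before_rest : J.IsRiemannSolution before before
  approaching : J.Approaching road (before road) arriving
  after_solves : J.IsRiemannSolution (Function.update before road arriving) after

namespace Interaction

variable {J} (I : J.Interaction)

/-- The Riemann data at the moment of the interaction. -/
def data : Fin 3 → ℝ := Function.update I.before I.road I.arriving

/-- Density jump of the arriving wave. -/
def Δρ_in : ℝ := I.arriving - I.before I.road

/-- Flux jump of the arriving wave. -/
def Δq_in : ℝ := (J.link I.road).f I.arriving - (J.link I.road).f (I.before I.road)

/-- Density jump of the wave produced on link `j` (zero if none is produced). For `j = I.road` this
is the wave sent back on the link of the arriving wave. -/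
def Δρ_out (j : Fin 3) : ℝ := I.after j - I.data j

/-- Flux jump of the wave produced on link `j`. -/
def Δq_out (j : Fin 3) : ℝ := (J.link j).f (I.after j) - (J.link j).f (I.data j)

/-- No wave is produced on the link of the arriving wave. -/
def NoReflection : Prop := I.after I.road = I.arriving

/-- The change of the interaction time if the arriving front is shifted in space by `ξ`. -/
def timeShift (ξ : ℝ) : ℝ := -ξ / (J.link I.road).speed (I.before I.road) I.arriving

/-- The spatial shift of the front produced on link `j`, if the arriving front is shifted by `ξ`: a
front of speed `s` that starts at the junction later by `τ` is shifted by `-s τ`. -/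
def shift_out (ξ : ℝ) (j : Fin 3) : ℝ :=
  -((J.link j).speed (I.data j) (I.after j) * I.timeShift ξ)

/-- Norm of the tangent vector given by the shift `ξ` of the arriving front. -/
def norm_in (ξ : ℝ) : ℝ := |ξ * I.Δρ_in|

/-- Norm of the tangent vector given by the resulting shift of the front produced on `j`. -/
def norm_out (ξ : ℝ) (j : Fin 3) : ℝ := |I.shift_out ξ j * I.Δρ_out j|

/-- The multiplication factor from the arriving wave to the wave produced on link `j`. -/
def factor (j : Fin 3) : ℝ := |I.Δq_out j| / |I.Δq_in|

end Interaction

/-- A chain of `n + 1` interactions with the junction: the wave produced on the link `out k` in the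
`k`-th interaction comes back to the junction on this link for the next one. In between, it may
have met other waves on the link, and other waves may have changed the state of the junction, so
the states in different interactions are not related. -/
structure InteractionChain (n : ℕ) where
  step : Fin (n + 1) → J.Interaction
  out : Fin (n + 1) → Fin 3
  returns : ∀ k : Fin n, (step k.succ).road = out k.castSucc

namespace InteractionChain

variable {J} {n : ℕ} (c : J.InteractionChain n)

/-- The accumulated multiplication factor. -/
def factor : ℝ := ∏ k, (c.step k).factor (c.out k)

/-- `ξ k` is the shift of the front arriving in the `k`-th interaction; the norm of the tangent
vector does not increase while the wave is on a link, between two interactions with the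
junction. -/
def Carries (ξ : Fin (n + 1) → ℝ) : Prop :=
  ∀ k : Fin n, (c.step k.succ).norm_in (ξ k.succ) ≤
    (c.step k.castSucc).norm_out (ξ k.castSucc) (c.out k.castSucc)

end InteractionChain

/-- The shifts produced in an interaction transform tangent vectors by the ratio of the flux
jumps. -/
def ShiftFormula : Prop :=
  ∀ (I : J.Interaction) (ξ : ℝ) (j : Fin 3),
    I.shift_out ξ j * I.Δρ_out j = I.Δq_out j / I.Δq_in * (ξ * I.Δρ_in) ∧
    I.norm_out ξ j = I.factor j * I.norm_in ξ

/-- Over any number of interactions with the junction, the accumulated multiplication factor is at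
most `C`, and the norm of a tangent vector is multiplied by at most `C`. -/
def TangentBound (C : ℝ) : Prop :=
  ∀ (n : ℕ) (c : J.InteractionChain n),
    c.factor ≤ C ∧
    ∀ ξ : Fin (n + 1) → ℝ, c.Carries ξ →
      (c.step (Fin.last n)).norm_out (ξ (Fin.last n)) (c.out (Fin.last n)) ≤
        C * (c.step 0).norm_in (ξ 0)

end Junction

/-- The table of multiplication factors of a diverge junction. -/
def γ (α₁ α₂ : ℝ) : Matrix (Fin 3) (Fin 3) ℝ :=
  !![1, α₁, α₂;
     1 / α₁, 1, α₂ / α₁;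
     1 / α₂, α₁ / α₂, 1]

end TrafficJunction

end

/-!
By the Rankine–Hugoniot relation `s Δρ = Δq`, the formula `ξⱼ = sⱼ ξᵢ / sᵢ` says that tangent
vectors are multiplied by `Δqⱼ / Δqᵢ`, so only flows matter. A front that reaches the junction comes
from the phase in which the demand (supply) is the flow itself. Hence it changes a single bound of
the junction, that of its own link, to the arriving flow. As a function of this bound `b`, the flow
on the link is `min b K` with `K` given by the other two bounds; it therefore ends up between the
old and the arriving flow, and the reflected wave is no stronger than the arriving one.

At a diverge all flows stay proportional to the shares `(1, α₁, α₂)`; `γ i j` is a quotient of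
shares, and such quotients telescope along a chain. At a merge the maximal flow closest to the
right-of-way line is
`q₀ = min m₀ (max (m₂ - m₁) (m₂ / (1 + p)))`, `q₁ = min m₁ (max (m₂ - m₀) (p m₂ / (1 + p)))`,
`q₂ = min m₂ (m₀ + m₁)`,
each of which is monotone in every bound. Together with `q₂ = q₀ + q₁` this shows that no flow
changes by more than the flow on the link of the arriving wave, so that every factor is at most `1`.
-/

namespace TrafficJunction

theorem mem_uIcc_of_le_of_lt_imp_le {α : Type*} [LinearOrder α] {a b c : α} (hcb : c ≤ b)
    (hac : c < b → a ≤ c) : c ∈ Set.uIcc a b := by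
  rcases hcb.eq_or_lt with rfl | hlt
  · exact Set.right_mem_uIcc
  · exact Set.mem_uIcc_of_le (hac hlt) hcb

theorem min_mem_uIcc_min {α : Type*} [LinearOrder α] (a b c : α) :
    min b c ∈ Set.uIcc (min a c) b :=
  mem_uIcc_of_le_of_lt_imp_le (min_le_left b c) fun h =>
    le_min ((min_le_right a c).trans ((min_lt_iff.1 h).resolve_left (lt_irrefl b)).le)
      (min_le_right a c)

namespace FundamentalDiagram

variable {F : FundamentalDiagram} {l r ρ ρ' : ℝ}

theorem speed_eq_slope : F.speed ρ ρ' = slope F.f ρ ρ' :=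
  (slope_def_field F.f ρ ρ').symm

theorem speed_mul_sub : F.speed ρ ρ' * (ρ' - ρ) = F.f ρ' - F.f ρ := by
  rw [speed_eq_slope, mul_comm, ← smul_eq_mul, sub_smul_slope, vsub_eq_sub]

theorem speed_nonneg_of_free (hρ : ρ ∈ Set.Icc 0 F.ρcrit) (hρ' : ρ' ∈ Set.Icc 0 F.ρcrit) :
    0 ≤ F.speed ρ ρ' :=
  speed_eq_slope ▸ F.strictMonoOn_f.monotoneOn.slope_nonneg hρ hρ'

theorem speed_nonpos_of_congested (hρ : ρ ∈ Set.Icc F.ρcrit F.ρjam)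
    (hρ' : ρ' ∈ Set.Icc F.ρcrit F.ρjam) : F.speed ρ ρ' ≤ 0 :=
  speed_eq_slope ▸ F.strictAntiOn_f.antitoneOn.slope_nonpos hρ hρ'

theorem IsFront.crit_le_right (h : F.IsFront l r) (hl : F.ρcrit < l) : F.ρcrit ≤ r := by
  obtain ⟨-, -, hlr | ⟨-, hfree | hcong⟩⟩ := h
  · exact (hl.trans hlr).le
  · exact absurd hl hfree.not_gt
  · exact hcong

theorem demand_eq_of_speed_pos (h : F.IsFront ρ' ρ) (hs : 0 < F.speed ρ ρ') :
    F.demand ρ' = F.f ρ' := by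
  refine if_neg fun hcong : F.ρcrit < ρ' => hs.not_ge ?_
  exact speed_nonpos_of_congested ⟨h.crit_le_right hcong, h.2.1.2⟩ ⟨hcong.le, h.1.2⟩

theorem supply_eq_of_speed_neg (h : F.IsFront ρ ρ') (hs : F.speed ρ ρ' < 0) :
    F.supply ρ' = F.f ρ' := by
  rcases lt_trichotomy ρ' F.ρcrit with hfree | rfl | hcong
  · have hρ : ρ ≤ F.ρcrit := le_of_not_gt fun hρ => hfree.not_ge (h.crit_le_right hρ)
    exact absurd (speed_nonneg_of_free ⟨h.1.1, hρ⟩ ⟨h.2.1.1, hfree.le⟩) hs.not_ge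
  · exact if_neg (lt_irrefl F.ρcrit)
  · exact if_pos hcong

end FundamentalDiagram

namespace Junction

variable {J : Junction} {g : Fin 3 → Fin 3 → ℝ}

namespace Interaction

variable (I : J.Interaction)

theorem data_road : I.data I.road = I.arriving :=
  Function.update_self ..

theorem data_of_ne {j : Fin 3} (hj : j ≠ I.road) : I.data j = I.before j :=
  Function.update_of_ne hj ..

theorem bound_data_of_ne {j : Fin 3} (hj : j ≠ I.road) :
    J.bound I.data j = J.bound I.before j := by
  simp only [bound, I.data_of_ne hj]

theorem bound_data_road : J.bound I.data I.road = (J.link I.road).f I.arriving := by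
  have happ := I.approaching
  unfold Approaching at happ
  unfold bound
  rw [data_road]
  cases hside : J.side I.road <;> simp only [hside] at happ ⊢
  · exact FundamentalDiagram.demand_eq_of_speed_pos happ.1 happ.2
  · exact FundamentalDiagram.supply_eq_of_speed_neg happ.1 happ.2

theorem speed_ne_zero : (J.link I.road).speed (I.before I.road) I.arriving ≠ 0 := by
  have happ := I.approaching
  unfold Approaching at happ
  split at happ
  · exact happ.2.ne'
  · exact happ.2.ne

theorem Δq_in_ne_zero : I.Δq_in ≠ 0 :=
  (div_ne_zero_iff.1 I.speed_ne_zero).1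

theorem rule_before : J.rule (J.bound I.before) fun k => (J.link k).f (I.before k) :=
  I.before_rest.2.2.1

theorem rule_after : J.rule (J.bound I.data) fun k => (J.link k).f (I.after k) :=
  I.after_solves.2.2.1

theorem factor_nonneg (j : Fin 3) : 0 ≤ I.factor j :=
  div_nonneg (abs_nonneg _) (abs_nonneg _)

theorem norm_in_nonneg (ξ : ℝ) : 0 ≤ I.norm_in ξ :=
  abs_nonneg _

theorem timeShift_eq (ξ : ℝ) : I.timeShift ξ = -(ξ * I.Δρ_in / I.Δq_in) := by
  rw [timeShift, FundamentalDiagram.speed, neg_div, div_div_eq_mul_div, Δρ_in, Δq_in]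

theorem shift_out_mul_Δρ_out (ξ : ℝ) (j : Fin 3) :
    I.shift_out ξ j * I.Δρ_out j = I.Δq_out j / I.Δq_in * (ξ * I.Δρ_in) := by
  have hspeed : (J.link j).speed (I.data j) (I.after j) * I.Δρ_out j = I.Δq_out j :=
    FundamentalDiagram.speed_mul_sub
  rw [shift_out, timeShift_eq, ← hspeed]
  ring

theorem norm_out_eq (ξ : ℝ) (j : Fin 3) : I.norm_out ξ j = I.factor j * I.norm_in ξ := by
  rw [norm_out, shift_out_mul_Δρ_out, abs_mul, abs_div, factor, norm_in]

end Interaction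

theorem shiftFormula (J : Junction) : J.ShiftFormula :=
  fun I ξ j => ⟨I.shift_out_mul_Δρ_out ξ j, I.norm_out_eq ξ j⟩

/-- The response of the junction to a change of the bound on a single link `i`: the flow on `i`
ends up between its old value and the new bound, and the flow on each link `j` changes by at most
`g i j` times as much as the flow on `i`. -/
def RespondsWithin (J : Junction) (g : Fin 3 → Fin 3 → ℝ) : Prop :=
  ∀ ⦃m m' q q' : Fin 3 → ℝ⦄ ⦃i : Fin 3⦄, J.rule m q → J.rule m' q' → (∀ j ≠ i, m' j = m j) →
    q' i ∈ Set.uIcc (q i) (m' i) ∧ ∀ j, |q' j - q j| ≤ g i j * |q' i - q i|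

namespace RespondsWithin

theorem flow_mem_uIcc (hJ : J.RespondsWithin g) (I : J.Interaction) :
    (J.link I.road).f (I.after I.road) ∈
      Set.uIcc ((J.link I.road).f (I.before I.road)) ((J.link I.road).f I.arriving) :=
  I.bound_data_road ▸ (hJ I.rule_before I.rule_after fun _ => I.bound_data_of_ne).1

theorem factor_road_le_one (hJ : J.RespondsWithin g) (I : J.Interaction) :
    I.factor I.road ≤ 1 := by
  refine div_le_one_of_le₀ ?_ (abs_nonneg _)
  rw [Interaction.Δq_out, I.data_road, abs_sub_comm]
  exact Set.abs_sub_right_of_mem_uIcc (hJ.flow_mem_uIcc I)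

theorem factor_le_of_ne (hJ : J.RespondsWithin g) (hg : ∀ i j, 0 ≤ g i j) (I : J.Interaction)
    {j : Fin 3} (hj : j ≠ I.road) : I.factor j ≤ g I.road j := by
  rw [Interaction.factor, div_le_iff₀ (abs_pos.2 I.Δq_in_ne_zero), Interaction.Δq_out,
    I.data_of_ne hj]
  calc |(J.link j).f (I.after j) - (J.link j).f (I.before j)|
      ≤ g I.road j *
          |(J.link I.road).f (I.after I.road) - (J.link I.road).f (I.before I.road)| :=
        (hJ I.rule_before I.rule_after fun _ => I.bound_data_of_ne).2 j
    _ ≤ g I.road j * |I.Δq_in| :=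
        mul_le_mul_of_nonneg_left (Set.abs_sub_left_of_mem_uIcc (hJ.flow_mem_uIcc I)) (hg _ _)

theorem factor_le (hJ : J.RespondsWithin g) (hg : ∀ i j, 0 ≤ g i j) (hg_self : ∀ i, 1 ≤ g i i)
    (I : J.Interaction) (j : Fin 3) : I.factor j ≤ g I.road j := by
  by_cases hj : j = I.road
  · exact hj ▸ (hJ.factor_road_le_one I).trans (hg_self I.road)
  · exact hJ.factor_le_of_ne hg I hj

end RespondsWithin

namespace InteractionChain

variable {n : ℕ}

/-- The chain without its last interaction, for inductions on the number of interactions. -/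
def dropLast (c : J.InteractionChain (n + 1)) : J.InteractionChain n where
  step k := c.step k.castSucc
  out k := c.out k.castSucc
  returns k := c.returns k.castSucc

theorem factor_eq_dropLast_mul (c : J.InteractionChain (n + 1)) :
    c.factor = c.dropLast.factor * (c.step (Fin.last (n + 1))).factor (c.out (Fin.last (n + 1))) :=
  Fin.prod_univ_castSucc _

theorem factor_nonneg (c : J.InteractionChain n) : 0 ≤ c.factor :=
  Finset.prod_nonneg fun k _ => (c.step k).factor_nonneg _

theorem factor_le (hfactor : ∀ (I : J.Interaction) j, I.factor j ≤ g I.road j)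
    (hg : ∀ i j k, g i j * g j k ≤ g i k) (c : J.InteractionChain n) :
    c.factor ≤ g (c.step 0).road (c.out (Fin.last n)) := by
  induction n with
  | zero => simpa [factor] using hfactor (c.step 0) (c.out 0)
  | succ n ih =>
    have hprev : c.dropLast.factor ≤ g (c.step 0).road (c.out (Fin.last n).castSucc) :=
      ih c.dropLast
    have hlast := hfactor (c.step (Fin.last n).succ) (c.out (Fin.last n).succ)
    rw [c.returns] at hlast
    rw [factor_eq_dropLast_mul]
    exact (mul_le_mul hprev hlast (Interaction.factor_nonneg _ _)
      (c.dropLast.factor_nonneg.trans hprev)).trans (hg _ _ _)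

theorem norm_out_le (c : J.InteractionChain n) {ξ : Fin (n + 1) → ℝ} (hξ : c.Carries ξ) :
    (c.step (Fin.last n)).norm_out (ξ (Fin.last n)) (c.out (Fin.last n)) ≤
      c.factor * (c.step 0).norm_in (ξ 0) := by
  induction n with
  | zero => simp [factor, Interaction.norm_out_eq]
  | succ n ih =>
    have hprev : (c.step (Fin.last n).succ).norm_in (ξ (Fin.last n).succ) ≤
        c.dropLast.factor * (c.step 0).norm_in (ξ 0) :=
      (hξ (Fin.last n)).trans (ih c.dropLast (ξ := fun k => ξ k.castSucc) fun k => hξ k.castSucc)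
    rw [factor_eq_dropLast_mul, Interaction.norm_out_eq, mul_comm c.dropLast.factor, mul_assoc]
    exact mul_le_mul_of_nonneg_left hprev (Interaction.factor_nonneg _ _)

end InteractionChain

theorem tangentBound_of_factor_le (hfactor : ∀ (I : J.Interaction) j, I.factor j ≤ g I.road j)
    (hg : ∀ i j k, g i j * g j k ≤ g i k) {C : ℝ} (hC : ∀ i j, g i j ≤ C) :
    J.TangentBound C := fun _ c => by
  have hc : c.factor ≤ C := (c.factor_le hfactor hg).trans (hC _ _)
  exact ⟨hc, fun ξ hξ => (c.norm_out_le hξ).trans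
    (mul_le_mul_of_nonneg_right hc ((c.step 0).norm_in_nonneg _))⟩

end Junction

section Diverge

variable {α₁ α₂ : ℝ}

/-- The share of the incoming flow that passes each link of a diverge; the incoming link carries
all of it. -/
def divergeShare (α₁ α₂ : ℝ) : Fin 3 → ℝ :=
  ![1, α₁, α₂]

theorem divergeShare_pos (h₁ : 0 < α₁) (h₂ : 0 < α₂) (i : Fin 3) : 0 < divergeShare α₁ α₂ i := by
  fin_cases i <;> simp [divergeShare, h₁, h₂]

theorem γ_eq_div (h₁ : 0 < α₁) (h₂ : 0 < α₂) (i j : Fin 3) :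
    γ α₁ α₂ i j = divergeShare α₁ α₂ j / divergeShare α₁ α₂ i := by
  fin_cases i <;> fin_cases j <;> simp [γ, divergeShare, h₁.ne', h₂.ne']

theorem γ_pos (h₁ : 0 < α₁) (h₂ : 0 < α₂) (i j : Fin 3) : 0 < γ α₁ α₂ i j :=
  γ_eq_div h₁ h₂ i j ▸ div_pos (divergeShare_pos h₁ h₂ j) (divergeShare_pos h₁ h₂ i)

theorem γ_self (i : Fin 3) : γ α₁ α₂ i i = 1 := by
  fin_cases i <;> rfl

theorem γ_mul (h₁ : 0 < α₁) (h₂ : 0 < α₂) (i j k : Fin 3) :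
    γ α₁ α₂ i j * γ α₁ α₂ j k = γ α₁ α₂ i k := by
  simp only [γ_eq_div h₁ h₂]
  exact div_mul_div_cancel₀' (divergeShare_pos h₁ h₂ j).ne' _ _

namespace IsDivergeFlux

variable {m m' q q' : Fin 3 → ℝ}

theorem flow_eq (hq : IsDivergeFlux α₁ α₂ m q) (k : Fin 3) :
    q k = divergeShare α₁ α₂ k * q 0 := by
  fin_cases k
  · exact (one_mul (q 0)).symm
  · exact hq.2.1
  · exact hq.2.2

theorem flow_le (h₁ : 0 < α₁) (h₂ : 0 < α₂) (hq : IsDivergeFlux α₁ α₂ m q) (k : Fin 3) :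
    q k ≤ m k := by
  obtain ⟨h, hq₁, hq₂⟩ := hq
  obtain ⟨hm₀, hm₁, hm₂⟩ : q 0 ≤ m 0 ∧ q 0 ≤ m 1 / α₁ ∧ q 0 ≤ m 2 / α₂ := by
    simpa only [le_min_iff] using h.le
  fin_cases k
  · exact hm₀
  · exact hq₁.trans_le ((le_div_iff₀' h₁).1 hm₁)
  · exact hq₂.trans_le ((le_div_iff₀' h₂).1 hm₂)

theorem exists_flow_eq_bound (h₁ : 0 < α₁) (h₂ : 0 < α₂) (hq : IsDivergeFlux α₁ α₂ m q) :
    ∃ k, q k = m k := by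
  obtain ⟨h, hq₁, hq₂⟩ := hq
  rcases min_choice (m 0) (min (m 1 / α₁) (m 2 / α₂)) with h₀ | h₀
  · exact ⟨0, h.trans h₀⟩
  rcases min_choice (m 1 / α₁) (m 2 / α₂) with h' | h' <;> rw [h₀, h'] at h
  · exact ⟨1, by rw [hq₁, h, mul_div_cancel₀ _ h₁.ne']⟩
  · exact ⟨2, by rw [hq₂, h, mul_div_cancel₀ _ h₂.ne']⟩

theorem sub_eq (h₁ : 0 < α₁) (h₂ : 0 < α₂) (hq : IsDivergeFlux α₁ α₂ m q)
    (hq' : IsDivergeFlux α₁ α₂ m' q') (i j : Fin 3) :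
    q' j - q j = γ α₁ α₂ i j * (q' i - q i) := by
  have hi := (divergeShare_pos h₁ h₂ i).ne'
  rw [γ_eq_div h₁ h₂, hq.flow_eq i, hq.flow_eq j, hq'.flow_eq i, hq'.flow_eq j]
  field_simp

theorem flow_mem_uIcc (h₁ : 0 < α₁) (h₂ : 0 < α₂) (hq : IsDivergeFlux α₁ α₂ m q)
    (hq' : IsDivergeFlux α₁ α₂ m' q') {i : Fin 3} (hm : ∀ j ≠ i, m' j = m j) :
    q' i ∈ Set.uIcc (q i) (m' i) := by
  refine mem_uIcc_of_le_of_lt_imp_le (hq'.flow_le h₁ h₂ i) fun hunsat => ?_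
  by_contra! hdecr
  have hdecr_all (k : Fin 3) : q' k < q k := by
    rw [← sub_neg, sub_eq h₁ h₂ hq hq' i k]
    exact mul_neg_of_pos_of_neg (γ_pos h₁ h₂ i k) (sub_neg.2 hdecr)
  obtain ⟨k, hk⟩ := hq'.exists_flow_eq_bound h₁ h₂
  have hki : k ≠ i := by
    rintro rfl
    exact hunsat.ne hk
  exact ((hdecr_all k).trans_le (hq.flow_le h₁ h₂ k)).ne (hk.trans (hm k hki))

end IsDivergeFlux

variable {link : Fin 3 → FundamentalDiagram}

theorem diverge_respondsWithin (h₁ : 0 < α₁) (h₂ : 0 < α₂) :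
    (diverge α₁ α₂ link).RespondsWithin (γ α₁ α₂) := fun _ _ _ _ i hq hq' hm =>
  ⟨IsDivergeFlux.flow_mem_uIcc h₁ h₂ hq hq' hm, fun j => by
    rw [IsDivergeFlux.sub_eq h₁ h₂ hq hq' i j, abs_mul, abs_of_pos (γ_pos h₁ h₂ i j)]⟩

theorem diverge_factor_le (h₁ : 0 < α₁) (h₂ : 0 < α₂) (I : (diverge α₁ α₂ link).Interaction)
    (j : Fin 3) : I.factor j ≤ γ α₁ α₂ I.road j :=
  (diverge_respondsWithin h₁ h₂).factor_le (fun i j => (γ_pos h₁ h₂ i j).le)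
    (fun i => (γ_self i).ge) I j

theorem diverge_factor_eq (h₁ : 0 < α₁) (h₂ : 0 < α₂) (I : (diverge α₁ α₂ link).Interaction)
    {j : Fin 3} (hj : j ≠ I.road) (hI : I.NoReflection) : I.factor j = γ α₁ α₂ I.road j := by
  have hout : I.Δq_out j = γ α₁ α₂ I.road j * I.Δq_in := by
    have hq : IsDivergeFlux α₁ α₂ _ fun k => (link k).f (I.before k) := I.rule_before
    have hq' : IsDivergeFlux α₁ α₂ _ fun k => (link k).f (I.after k) := I.rule_after
    rw [Junction.Interaction.Δq_out, I.data_of_ne hj, Junction.Interaction.Δq_in, ← hI]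
    exact hq.sub_eq h₁ h₂ hq' I.road j
  rw [Junction.Interaction.factor, hout, abs_mul, abs_of_pos (γ_pos h₁ h₂ _ _),
    mul_div_cancel_right₀ _ (abs_ne_zero.2 I.Δq_in_ne_zero)]

theorem exists_diverge_tangentBound (h₁ : 0 < α₁) (h₂ : 0 < α₂) :
    ∃ C : ℝ, ∀ link, (diverge α₁ α₂ link).TangentBound C := by
  obtain ⟨C, hC⟩ := Finite.exists_le fun ij : Fin 3 × Fin 3 => γ α₁ α₂ ij.1 ij.2
  exact ⟨C, fun _ => Junction.tangentBound_of_factor_le (diverge_factor_le h₁ h₂)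
    (fun i j k => (γ_mul h₁ h₂ i j k).le) fun i j => hC (i, j)⟩

end Diverge

section Merge

variable {p : ℝ}

namespace IsMergeFlux

variable {m m' q q' : Fin 3 → ℝ}

theorem total_eq (hq : IsMergeFlux p m q) : q 2 = min (m 2) (m 0 + m 1) := by
  obtain ⟨⟨hx, hxm, hy, hym, hs⟩, hsum, hmax, -⟩ := hq
  have hfeasible : MergeFeasible m (min (m 0) (m 2)) (min (m 1) (m 2 - min (m 0) (m 2))) := by
    unfold MergeFeasible
    grind
  have htotal_le := hmax _ _ hfeasible
  grind

theorem abs_sub_share_le (hp : 0 ≤ p) (hq : IsMergeFlux p m q) {x y : ℝ}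
    (hfeasible : MergeFeasible m x y) (htotal : x + y = q 2) :
    |q 0 - q 2 / (1 + p)| ≤ |x - q 2 / (1 + p)| := by
  have hp' : 0 < 1 + p := by linarith
  have hdist {x y : ℝ} (h : x + y = q 2) : |p * x - y| = (1 + p) * |x - q 2 / (1 + p)| := by
    rw [← abs_of_pos hp', ← abs_mul, abs_of_pos hp', mul_sub, mul_div_cancel₀ _ hp'.ne', ← h]
    ring_nf
  have hclose := hq.2.2.2 x y hfeasible (htotal.trans hq.2.1)
  rw [hdist htotal, hdist hq.2.1.symm] at hclose
  exact le_of_mul_le_mul_left hclose hp'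

theorem share_mem_Icc (hp : 0 ≤ p) (hq : IsMergeFlux p m q) :
    q 2 / (1 + p) ∈ Set.Icc 0 (q 2) := by
  obtain ⟨⟨hx, -, hy, -⟩, hsum, -⟩ := hq
  have htotal : 0 ≤ q 2 := hsum ▸ add_nonneg hx hy
  exact ⟨by positivity, div_le_self htotal (by linarith)⟩

theorem flow_zero_eq_demand (hp : 0 ≤ p) (hq : IsMergeFlux p m q) (hlt : q 0 < q 2 / (1 + p)) :
    q 0 = m 0 := by
  have hshare := (hq.share_mem_Icc hp).2
  obtain ⟨hx, hxm, -, hym, hs⟩ := hq.1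
  have hsum : q 2 = q 0 + q 1 := hq.2.1
  have hfeasible : MergeFeasible m (min (m 0) (q 2 / (1 + p)))
      (q 2 - min (m 0) (q 2 / (1 + p))) := by
    unfold MergeFeasible
    grind
  have hclosest := hq.abs_sub_share_le hp hfeasible (by ring)
  grind

theorem flow_one_eq_demand (hp : 0 ≤ p) (hq : IsMergeFlux p m q) (hlt : q 2 / (1 + p) < q 0) :
    q 1 = m 1 := by
  obtain ⟨hshare₀, hshare₁⟩ := hq.share_mem_Icc hp
  obtain ⟨-, hxm, hy, hym, hs⟩ := hq.1
  have hsum : q 2 = q 0 + q 1 := hq.2.1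
  have hfeasible : MergeFeasible m (max (q 2 - m 1) (q 2 / (1 + p)))
      (q 2 - max (q 2 - m 1) (q 2 / (1 + p))) := by
    unfold MergeFeasible
    grind
  have hclosest := hq.abs_sub_share_le hp hfeasible (by ring)
  grind

theorem flow_zero_eq (hp : 0 ≤ p) (hq : IsMergeFlux p m q) :
    q 0 = min (m 0) (max (m 2 - m 1) (m 2 / (1 + p))) := by
  obtain ⟨-, hxm, -, hym, hs⟩ := hq.1
  have hsum : q 2 = q 0 + q 1 := hq.2.1
  rcases le_total (m 2) (m 0 + m 1) with hsupply | hdemand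
  · have htotal : q 2 = m 2 := hq.total_eq.trans (min_eq_left hsupply)
    have h₀ := hq.flow_zero_eq_demand hp
    have h₁ := hq.flow_one_eq_demand hp
    rw [htotal] at h₀ h₁
    grind
  · have htotal : q 2 = m 0 + m 1 := hq.total_eq.trans (min_eq_right hdemand)
    rw [min_eq_left (le_max_of_le_left (by linarith))]
    linarith

theorem flow_one_eq (hp : 0 ≤ p) (hq : IsMergeFlux p m q) :
    q 1 = min (m 1) (max (m 2 - m 0) (p * (m 2 / (1 + p)))) := by
  have hshare : p * (m 2 / (1 + p)) = m 2 - m 2 / (1 + p) := by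
    field_simp
    ring
  obtain ⟨-, hxm, -, hym, -⟩ := hq.1
  have hsum : q 2 = q 0 + q 1 := hq.2.1
  rw [hshare]
  rcases le_total (m 2) (m 0 + m 1) with hsupply | hdemand
  · have htotal : q 2 = m 2 := hq.total_eq.trans (min_eq_left hsupply)
    have h₀ := hq.flow_zero_eq hp
    grind only [= min_def, = max_def]
  · have htotal : q 2 = m 0 + m 1 := hq.total_eq.trans (min_eq_right hdemand)
    rw [min_eq_left (le_max_of_le_left (by linarith))]
    linarith

theorem flow_zero_le (hp : 0 ≤ p) (hq : IsMergeFlux p m q) (hq' : IsMergeFlux p m' q')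
    (h₀ : m 0 ≤ m' 0) (h₁ : m' 1 ≤ m 1) (h₂ : m 2 ≤ m' 2) : q 0 ≤ q' 0 := by
  rw [hq.flow_zero_eq hp, hq'.flow_zero_eq hp]
  gcongr

theorem flow_one_le (hp : 0 ≤ p) (hq : IsMergeFlux p m q) (hq' : IsMergeFlux p m' q')
    (h₀ : m' 0 ≤ m 0) (h₁ : m 1 ≤ m' 1) (h₂ : m 2 ≤ m' 2) : q 1 ≤ q' 1 := by
  rw [hq.flow_one_eq hp, hq'.flow_one_eq hp]
  gcongr

theorem total_le (hq : IsMergeFlux p m q) (hq' : IsMergeFlux p m' q') (hm : m ≤ m') :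
    q 2 ≤ q' 2 := by
  rw [hq.total_eq, hq'.total_eq]
  exact min_le_min (hm 2) (add_le_add (hm 0) (hm 1))

theorem flow_mem_uIcc (hp : 0 ≤ p) (hq : IsMergeFlux p m q) (hq' : IsMergeFlux p m' q')
    {i : Fin 3} (hm : ∀ j ≠ i, m' j = m j) : q' i ∈ Set.uIcc (q i) (m' i) := by
  fin_cases i
  · simpa [hq.flow_zero_eq hp, hq'.flow_zero_eq hp, hm] using min_mem_uIcc_min _ _ _
  · simpa [hq.flow_one_eq hp, hq'.flow_one_eq hp, hm] using min_mem_uIcc_min _ _ _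
  · simpa [hq.total_eq, hq'.total_eq, hm] using min_mem_uIcc_min _ _ _

theorem abs_sub_le (hp : 0 ≤ p) (hq : IsMergeFlux p m q) (hq' : IsMergeFlux p m' q')
    {i : Fin 3} (hm : ∀ j ≠ i, m' j = m j) (j : Fin 3) : |q' j - q j| ≤ |q' i - q i| := by
  wlog hle : m i ≤ m' i generalizing m m' q q'
  · rw [abs_sub_comm, abs_sub_comm (q' i)]
    exact this hq' hq (fun k hk => (hm k hk).symm) (le_of_not_ge hle)
  have hmm' : m ≤ m' := fun k => by
    by_cases hk : k = i
    · exact hk ▸ hle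
    · exact (hm k hk).ge
  have htotal : q 2 ≤ q' 2 := hq.total_le hq' hmm'
  have hsum : q 2 = q 0 + q 1 := hq.2.1
  have hsum' : q' 2 = q' 0 + q' 1 := hq'.2.1
  fin_cases i
  · have hdec : q' 1 ≤ q 1 :=
      hq'.flow_one_le hp hq (hmm' 0) (hm 1 (by decide)).le (hm 2 (by decide)).le
    fin_cases j <;> grind
  · have hdec : q' 0 ≤ q 0 :=
      hq'.flow_zero_le hp hq (hm 0 (by decide)).le (hmm' 1) (hm 2 (by decide)).le
    fin_cases j <;> grind
  · have hinc₀ : q 0 ≤ q' 0 := hq.flow_zero_le hp hq' (hmm' 0) (hm 1 (by decide)).le (hmm' 2)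
    have hinc₁ : q 1 ≤ q' 1 := hq.flow_one_le hp hq' (hm 0 (by decide)).le (hmm' 1) (hmm' 2)
    fin_cases j <;> grind

end IsMergeFlux

variable {link : Fin 3 → FundamentalDiagram}

theorem merge_respondsWithin_one (hp : 0 ≤ p) : (merge p link).RespondsWithin fun _ _ => 1 :=
  fun _ _ _ _ _ hq hq' hm => ⟨IsMergeFlux.flow_mem_uIcc hp hq hq' hm, fun j =>
    (IsMergeFlux.abs_sub_le hp hq hq' hm j).trans_eq (one_mul _).symm⟩

theorem merge_tangentBound_one (hp : 0 ≤ p) : (merge p link).TangentBound 1 :=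
  Junction.tangentBound_of_factor_le
    ((merge_respondsWithin_one hp).factor_le (fun _ _ => zero_le_one) fun _ => le_rfl)
    (fun _ _ _ => (one_mul 1).le) fun _ _ => le_rfl

end Merge

end TrafficJunction

open TrafficJunction in
theorem mainTheorem2_general :
    (∀ α₁ α₂ : ℝ, 0 < α₁ → 0 < α₂ →
      (∀ i j k, γ α₁ α₂ i j * γ α₁ α₂ j k = γ α₁ α₂ i k) ∧
      (∀ link : Fin 3 → FundamentalDiagram,
        (diverge α₁ α₂ link).ShiftFormula ∧
        ∀ (I : (diverge α₁ α₂ link).Interaction) (j : Fin 3), j ≠ I.road →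
          I.factor j ≤ γ α₁ α₂ I.road j ∧
          (I.NoReflection → I.factor j = γ α₁ α₂ I.road j)) ∧
      ∃ C : ℝ, ∀ link : Fin 3 → FundamentalDiagram, (diverge α₁ α₂ link).TangentBound C) ∧
    (∀ p : ℝ, 0 ≤ p → ∀ link : Fin 3 → FundamentalDiagram,
      (merge p link).ShiftFormula ∧ (merge p link).TangentBound 1) := by
  refine ⟨fun α₁ α₂ h₁ h₂ => ⟨γ_mul h₁ h₂, fun link => ⟨Junction.shiftFormula _, ?_⟩,
    exists_diverge_tangentBound h₁ h₂⟩, fun p hp link => ⟨Junction.shiftFormula _, ?_⟩⟩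
  · exact fun I j hj => ⟨diverge_factor_le h₁ h₂ I j, diverge_factor_eq h₁ h₂ I hj⟩
  · exact merge_tangentBound_one hp

open TrafficJunction in
theorem mainTheorem2 :
    -- diverge junctions
    (∀ α₁ α₂ : ℝ, 0 < α₁ → 0 < α₂ → α₁ + α₂ = 1 →
      (∀ i j k, γ α₁ α₂ i j * γ α₁ α₂ j k = γ α₁ α₂ i k) ∧
      (∀ link : Fin 3 → FundamentalDiagram,
        (diverge α₁ α₂ link).ShiftFormula ∧
        ∀ (I : (diverge α₁ α₂ link).Interaction) (j : Fin 3), j ≠ I.road →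
          I.factor j ≤ γ α₁ α₂ I.road j ∧
          (I.NoReflection → I.factor j = γ α₁ α₂ I.road j)) ∧
      ∃ C : ℝ, ∀ link : Fin 3 → FundamentalDiagram, (diverge α₁ α₂ link).TangentBound C) ∧
    -- merge junctions
    (∀ p : ℝ, 0 < p → p < 1 →
      (∀ link : Fin 3 → FundamentalDiagram, (merge p link).ShiftFormula) ∧
      ∃ C : ℝ, ∀ link : Fin 3 → FundamentalDiagram, (merge p link).TangentBound C) := by
  obtain ⟨hdiverge, hmerge⟩ := mainTheorem2_general
  exact ⟨fun α₁ α₂ h₁ h₂ _ => hdiverge α₁ α₂ h₁ h₂, fun p hp _ =>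
    ⟨fun link => (hmerge p hp.le link).1, 1, fun link => (hmerge p hp.le link).2⟩⟩
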